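/- Let $d\ge 2$ and $\mathbb I=[0,1]$. Call continuous functions $\varphi_{pq}:\mathbb I\to\mathbb R$ ($p=1,\dots,d$, $q=1,\dots,2d+1$) Kolmogorov inner functions if, with $$s_q(x_1,\dots,x_d)=\sum_{p=1}^{d}\varphi_{pq}(x_p),\qquad q=1,\dots,2d+1,$$ every continuous function $f:\mathbb I^d\to\mathbb R$ can be written as $f(x)=\sum_{q=1}^{2d+1}g_q(s_q(x))$ for all $x\in\mathbb I^d$, with continuous functions $g_q:\mathbb R\to\mathbb R$ depending on $f$. Then Kolmogorov inner functions exist, and for every choice of them, every function $f:\mathbb I^d\to\mathbb R$ (not necessarily continuous) can be written as $$f(x)=\sum_{q=1}^{2d+1}g_q(s_q(x)),\qquad x\in\mathbb I^d,$$ with functions $g_q:\mathbb R\to\mathbb R$ (not necessarily continuous) depending on $f$. -/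

import Mathlib

/-- For continuous `φ p q : [0,1] → ℝ`, the function on the unit cube `[0,1]^d` with index `q`,
`s_q(x) = ∑ p, φ_{pq}(x_p)`. -/
def innerSum {d m : ℕ} (φ : Fin d → Fin m → C(unitInterval, ℝ)) (q : Fin m)
    (x : Fin d → unitInterval) : ℝ :=
  ∑ p, φ p q (x p)

/-- The `2d+1` functions `s_q = innerSum φ q` are Kolmogorov functions: every continuous function
on the cube is `∑ q, g_q ∘ s_q` with continuous univariate `g_q`. -/
def IsKolmogorov {d : ℕ} (φ : Fin d → Fin (2 * d + 1) → C(unitInterval, ℝ)) : Prop :=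
  ∀ f : (Fin d → unitInterval) → ℝ, Continuous f →
    ∃ g : Fin (2 * d + 1) → ℝ → ℝ,
      (∀ q, Continuous (g q)) ∧ ∀ x, f x = ∑ q, g q (innerSum φ q x)

/-!
# Kolmogorov superpositions of arbitrary functions

*Existence of inner functions* is proved by the Baire category argument of Kahane and Hedberg. For
a fixed nonzero `f` on the cube, consider the set of systems `φ` for which some outer functions `g`
with `‖g‖ ≤ ‖f‖` approximate `f` with error less than `(1 - 1 / (2 (d + 1))) ‖f‖`. It is open
(`isOpen_approxSet`) and dense (`dense_approxSet`), so a generic `φ` belongs to it for all nonzero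
`f` in a countable dense set, hence, with a slightly worse constant, for all `f`. Iterating the
approximation on the error (`surjective_of_approx`) represents every `f` exactly.

Density (`exists_near_approx`) is where the number `2 d + 1` enters. Replace each `φ p q` by a
nearby function that is constant on the steps of a staircase of mesh `1 / N`, shifted by
`q / (2 d + 1)` of a step; the rises of the `2 d + 1` staircases are disjoint. Each coordinate of a
point `x` lies on the rise of at most one staircase, so `x` lies in a cell (a product of steps) for
at least `d + 1` of the indices `q`. For a generic perturbation `innerSum φ q` separates the cells,
and `g q` can be chosen to be about `f / (d + 1)` on each of them and at most `‖f‖ / (d + 1)`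
everywhere. Then `d + 1` good indices reproduce `f` up to a small error and the other `d` contribute
at most `d / (d + 1) * ‖f‖`.

*Arbitrary functions* are reached by linear algebra. If every continuous `f` is of the form
`∑ q, g q ∘ s q`, then a finitely supported `μ : X →₀ ℝ` whose images under all `s q` vanish
annihilates every continuous function, so it is zero
(`finsupp_eq_zero_of_mapDomain_eq_zero`). Thus the linear map
`(X →₀ ℝ) → (ι → Y →₀ ℝ)`, `μ ↦ (s q)_* μ`, is injective, and its dual map, which is essentially
`g ↦ ∑ q, g q ∘ s q` on all functions, is surjective (`exists_eq_sum_comp`).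
-/

/-! ### From continuous functions to arbitrary functions -/

/-- If no nonzero finitely supported `μ` has all its images under the `s q` equal to zero, then
every function is a sum of functions of the `s q`: functions on `X` are the linear forms on
`X →₀ ℝ`, and the dual of an injective linear map is surjective. -/
theorem exists_eq_sum_comp {X Y ι : Type*} [Fintype ι] (s : ι → X → Y)
    (h : ∀ μ : X →₀ ℝ, (∀ q, Finsupp.mapDomain (s q) μ = 0) → μ = 0) (f : X → ℝ) :
    ∃ g : ι → Y → ℝ, ∀ x, f x = ∑ q, g q (s q x) := by
  classical
  let T : (X →₀ ℝ) →ₗ[ℝ] (ι → Y →₀ ℝ) := LinearMap.pi fun q => Finsupp.lmapDomain ℝ ℝ (s q)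
  have hT : Function.Injective T := by
    refine (injective_iff_map_eq_zero T).2 fun μ hμ => h μ fun q => ?_
    simpa [T] using congrFun hμ q
  obtain ⟨ψ, hψ⟩ := LinearMap.dualMap_surjective_of_injective hT (Finsupp.linearCombination ℝ f)
  -- `g q` is the `q`-th component of `ψ`, evaluated at point masses
  refine ⟨fun q y => ψ (Pi.single q (Finsupp.single y 1)), fun x => ?_⟩
  have h1 : ψ (T (Finsupp.single x 1)) = f x := by
    simpa using LinearMap.congr_fun hψ (Finsupp.single x 1)
  have h2 : T (Finsupp.single x 1) = fun q => Finsupp.single (s q x) 1 := by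
    ext1 q
    simp [T, Finsupp.mapDomain_single]
  rw [← h1, h2, ← map_sum, Finset.univ_sum_single]

/-- If all continuous functions are sums of functions of the `s q`, then a finitely supported `μ`
killed by all the `s q` integrates every continuous function to zero, and continuous functions
separate a point of the support from the rest of it. -/
theorem finsupp_eq_zero_of_mapDomain_eq_zero {X Y ι : Type*} [TopologicalSpace X] [T4Space X]
    [Fintype ι] (s : ι → X → Y)
    (hs : ∀ f : X → ℝ, Continuous f → ∃ g : ι → Y → ℝ, ∀ x, f x = ∑ q, g q (s q x))
    (μ : X →₀ ℝ) (hμ : ∀ q, Finsupp.mapDomain (s q) μ = 0) : μ = 0 := by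
  classical
  by_contra hne
  obtain ⟨x₀, hx₀⟩ := Finsupp.support_nonempty_iff.2 hne
  obtain ⟨f, hf0, hf1, -⟩ := exists_continuous_zero_one_of_isClosed
    (μ.support.erase x₀).finite_toSet.isClosed (isClosed_singleton (x := x₀))
    (by simp)
  obtain ⟨g, hg⟩ := hs f f.continuous
  have h0 : ∀ q, (μ.sum fun x a => a * g q (s q x)) = 0 := fun q => by
    rw [← Finsupp.sum_mapDomain_index (f := s q) (h := fun y a => a * g q y) (by simp)
      (by intros; ring), hμ q, Finsupp.sum_zero_index]
  have h1 : (μ.sum fun x a => a * f x) = 0 := by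
    simp only [hg, Finset.mul_sum, Finsupp.sum] at h0 ⊢
    rw [Finset.sum_comm]
    exact Finset.sum_eq_zero fun q _ => h0 q
  have h2 : (μ.sum fun x a => a * f x) = μ x₀ := by
    rw [Finsupp.sum, Finset.sum_eq_single_of_mem x₀ hx₀]
    · have := hf1 (Set.mem_singleton x₀)
      simp_all
    · intro x hx hxx
      have := hf0 (x := x) (by simp_all)
      simp_all
  exact (Finsupp.mem_support_iff.1 hx₀) (h2.symm.trans h1)

/-! ### Successive approximation -/

/-- A continuous linear map is surjective if every `y` can be approximated by values at vectors of
comparable norm up to a fixed proportion `r < 1` of `‖y‖`: apply this to the successive errors and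
sum the geometric series. -/
theorem surjective_of_approx {E F : Type*} [NormedAddCommGroup E] [NormedSpace ℝ E]
    [CompleteSpace E] [NormedAddCommGroup F] [NormedSpace ℝ F] (T : E →L[ℝ] F) {C r : ℝ}
    (hr0 : 0 ≤ r) (hr : r < 1) (h : ∀ y, ∃ x, ‖x‖ ≤ C * ‖y‖ ∧ ‖y - T x‖ ≤ r * ‖y‖) :
    Function.Surjective T := by
  choose S hSC hSr using h
  intro y
  -- `e n` is the error left after `n` steps
  let e : ℕ → F := fun n => (fun z => z - T (S z))^[n] y
  have hsucc : ∀ n, e (n + 1) = e n - T (S (e n)) := fun n => Function.iterate_succ_apply' _ _ _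
  have he : ∀ n, ‖e n‖ ≤ r ^ n * ‖y‖ := by
    intro n
    induction n with
    | zero => simp [e]
    | succ n ih =>
      rw [hsucc, pow_succ']
      calc _ ≤ r * ‖e n‖ := hSr _
        _ ≤ r * (r ^ n * ‖y‖) := by gcongr
        _ = _ := by ring
  have hsum : Summable fun n => S (e n) := by
    refine Summable.of_norm_bounded (g := fun n => |C| * (r ^ n * ‖y‖))
      (((summable_geometric_of_lt_one hr0 hr).mul_right _).mul_left _) fun n => ?_
    calc ‖S (e n)‖ ≤ C * ‖e n‖ := hSC _
      _ ≤ |C| * ‖e n‖ := by gcongr; exact le_abs_self C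
      _ ≤ _ := by gcongr; exact he n
  have hpart : ∀ n, ∑ i ∈ Finset.range n, T (S (e i)) = y - e n := by
    intro n
    induction n with
    | zero => simp [e]
    | succ n ih => rw [Finset.sum_range_succ, ih, hsucc]; abel
  have he0 : Filter.Tendsto e Filter.atTop (nhds 0) := by
    refine squeeze_zero_norm he ?_
    simpa using (tendsto_pow_atTop_nhds_zero_of_lt_one hr0 hr).mul_const ‖y‖
  refine ⟨∑' n, S (e n), tendsto_nhds_unique (T.hasSum hsum.hasSum).tendsto_sum_nat ?_⟩
  simp only [hpart]
  simpa using he0.const_sub y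

/-! ### Separating the cells -/

/-- A generic small multiple of an injective function, added to finitely many given functions on a
finite set, makes all of them injective: each pair of points excludes at most one `t`. -/
theorem exists_pos_lt_injective {ι K : Type*} [Finite ι] [Finite K] (A : ι → K → ℝ) {B : K → ℝ}
    (hB : Function.Injective B) {t₀ : ℝ} (ht₀ : 0 < t₀) :
    ∃ t, 0 < t ∧ t < t₀ ∧ ∀ q, Function.Injective fun k => A q k + t * B k := by
  have hfin : (Set.range fun z : ι × K × K =>
      (A z.1 z.2.2 - A z.1 z.2.1) / (B z.2.1 - B z.2.2)).Finite := Set.finite_range _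
  obtain ⟨t, ⟨ht0, ht1⟩, ht⟩ := ((Set.Ioo_infinite ht₀).sdiff hfin).nonempty
  refine ⟨t, ht0, ht1, fun q k k' hkk => ?_⟩
  by_contra hne
  refine ht ⟨(q, k, k'), ?_⟩
  have : B k - B k' ≠ 0 := sub_ne_zero.2 (hB.ne hne)
  simp only at hkk ⊢
  rw [div_eq_iff this]
  linarith

/-- Uniqueness of the expansion in base `N`. -/
theorem injective_sum_mul_pow (d N : ℕ) :
    Function.Injective fun k : Fin d → Fin N => ∑ p, (k p : ℝ) * (N : ℝ) ^ (p : ℕ) := by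
  intro k k' h
  apply finFunctionFinEquiv.injective
  apply Fin.ext
  rw [finFunctionFinEquiv_apply, finFunctionFinEquiv_apply]
  beta_reduce at h
  exact_mod_cast h

/-! ### Shifted staircases -/

/-- The continuous monotone staircase (for `1 ≤ L`) that equals the integer `n` on
`[n, n + (L - 1) / L]` and rises linearly to `n + 1` on the remaining `1 / L` of the unit
interval. -/
noncomputable def staircase (L : ℕ) (y : ℝ) : ℝ :=
  y - min (Int.fract y) ((L - 1) * (1 - Int.fract y))

theorem continuous_staircase {L : ℕ} (hL : 1 ≤ L) : Continuous (staircase L) := by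
  have hL' : (1 : ℝ) ≤ L := by exact_mod_cast hL
  refine continuous_id.sub (ContinuousOn.comp_fract'' (f := fun u : ℝ => min u ((L - 1) * (1 - u)))
    (by fun_prop) ?_)
  simpa using hL'

theorem abs_staircase_sub_le {L : ℕ} (hL : 1 ≤ L) (y : ℝ) : |staircase L y - y| ≤ 1 := by
  have hL' : (1 : ℝ) ≤ L := by exact_mod_cast hL
  have h0 := Int.fract_nonneg y
  have h1 := Int.fract_lt_one y
  have h2 : 0 ≤ min (Int.fract y) ((L - 1) * (1 - Int.fract y)) :=
    le_min h0 (mul_nonneg (by linarith) (by linarith))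
  have h3 := min_le_left (Int.fract y) ((L - 1) * (1 - Int.fract y))
  rw [staircase, abs_le]
  constructor <;> linarith

/-- The staircase is flat where `Int.fract y ≤ (L - 1) / L`, stated without division. -/
theorem staircase_eq_floor {L : ℕ} {y : ℝ} (h : L * Int.fract y ≤ L - 1) :
    staircase L y = ⌊y⌋ := by
  rw [staircase, min_eq_left (by linarith), Int.self_sub_fract]

/-- The rises of the staircases shifted by `q / L`, `q < L`, are disjoint. -/
theorem eq_of_lt_fract_add_div {L : ℕ} {y : ℝ} {q q' : Fin L}
    (h : (L : ℝ) - 1 < L * Int.fract (y + q / L)) (h' : (L : ℝ) - 1 < L * Int.fract (y + q' / L)) :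
    q = q' := by
  have hL : (0 : ℝ) < L := by exact_mod_cast q.pos
  have h1 := Int.fract_lt_one (y + q / L)
  have h1' := Int.fract_lt_one (y + q' / L)
  have e := Int.self_sub_fract (y + q / L)
  have e' := Int.self_sub_fract (y + q' / L)
  have h2 : L * Int.fract (y + q / L) < L := by nlinarith
  have h2' : L * Int.fract (y + q' / L) < L := by nlinarith
  -- the fractional parts differ by less than `1 / L` and, up to an integer, by `(q - q') / L`
  have key : ((q : ℤ) - q' - L * (⌊y + q / L⌋ - ⌊y + q' / L⌋) : ℝ)
      = L * Int.fract (y + q / L) - L * Int.fract (y + q' / L) := by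
    rw [← e, ← e']
    field_simp
    push_cast
    ring
  have k1 : ((q : ℤ) - q' - L * (⌊y + q / L⌋ - ⌊y + q' / L⌋) : ℤ) < 1 := by
    have : ((q : ℤ) - q' - L * (⌊y + q / L⌋ - ⌊y + q' / L⌋) : ℝ) < 1 := by linarith
    exact_mod_cast this
  have k2 : -1 < ((q : ℤ) - q' - L * (⌊y + q / L⌋ - ⌊y + q' / L⌋) : ℤ) := by
    have : -1 < ((q : ℤ) - q' - L * (⌊y + q / L⌋ - ⌊y + q' / L⌋) : ℝ) := by linarith
    exact_mod_cast this
  have k3 : (q : ℤ) - q' = L * (⌊y + q / L⌋ - ⌊y + q' / L⌋) := by omega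
  have k4 : (q : ℤ) - q' = 0 :=
    Int.eq_zero_of_abs_lt_dvd ⟨_, k3⟩ (by rw [abs_lt]; have := q.2; have := q'.2; omega)
  apply Fin.ext
  omega

/-- At most `d` of the shifted staircases have one of the `d` given points on a rise: map such a
staircase to a coordinate on its rise. -/
theorem card_filter_exists_lt_fract_le {d L : ℕ} (y : Fin d → ℝ) :
    (Finset.univ.filter fun q : Fin L =>
      ∃ p, (L : ℝ) - 1 < L * Int.fract (y p + q / L)).card ≤ d := by
  classical
  simpa using Finset.card_le_card_of_forall_subsingleton (t := (Finset.univ : Finset (Fin d)))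
    (fun (q : Fin L) p => (L : ℝ) - 1 < L * Int.fract (y p + q / L))
    (fun q hq => by simpa using hq)
    (fun p _ q hq q' hq' => eq_of_lt_fract_add_div hq.2 hq'.2)

/-! ### Approximation with perturbed inner functions -/

/-- If at least `d + 1` of the `2 d + 1` numbers `c q` are close to `a / (d + 1)`, and all are at
most `M / (d + 1)`, then exactly `d + 1` good ones sum up to about `a`, and the other `d`, good or
not, contribute at most `d / (d + 1) * M`. -/
theorem abs_sub_sum_le {d : ℕ} {G : Finset (Fin (2 * d + 1))} (hG : d + 1 ≤ G.card)
    {a M ε : ℝ} {c : Fin (2 * d + 1) → ℝ} (hc : ∀ q, |c q| ≤ M / (d + 1))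
    (hgood : ∀ q ∈ G, |a / (d + 1) - c q| ≤ ε / (d + 1)) :
    |a - ∑ q, c q| ≤ d / (d + 1) * M + ε := by
  classical
  obtain ⟨T, hTG, hT⟩ := Finset.exists_subset_card_eq hG
  have hTc : Tᶜ.card = d := by
    rw [Finset.card_compl, hT, Fintype.card_fin]; omega
  have hd : (d + 1 : ℝ) ≠ 0 := by positivity
  have e : a - ∑ q, c q = ∑ q ∈ T, (a / (d + 1) - c q) - ∑ q ∈ Tᶜ, c q := by
    rw [← Finset.sum_add_sum_compl T, Finset.sum_sub_distrib, Finset.sum_const, hT, nsmul_eq_mul]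
    push_cast
    rw [mul_div_cancel₀ _ hd]
    ring
  rw [e]
  have h1 : |∑ q ∈ T, (a / (d + 1) - c q)| ≤ ε := by
    calc _ ≤ ∑ q ∈ T, |a / (d + 1) - c q| := Finset.abs_sum_le_sum_abs _ _
      _ ≤ T.card • (ε / (d + 1)) := Finset.sum_le_card_nsmul _ _ _ fun q hq => hgood q (hTG hq)
      _ = ε := by rw [hT, nsmul_eq_mul]; push_cast; field_simp
  have h2 : |∑ q ∈ Tᶜ, c q| ≤ d / (d + 1) * M := by
    calc _ ≤ ∑ q ∈ Tᶜ, |c q| := Finset.abs_sum_le_sum_abs _ _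
      _ ≤ Tᶜ.card • (M / (d + 1)) := Finset.sum_le_card_nsmul _ _ _ fun q _ => hc q
      _ = _ := by rw [hTc, nsmul_eq_mul]; ring
  linarith [abs_sub (∑ q ∈ T, (a / (d + 1) - c q)) (∑ q ∈ Tᶜ, c q)]
open scoped BoundedContinuousFunction

/-- Interpolation at finitely many reals, without increasing the bound (Tietze). -/
theorem exists_boundedContinuous_eq {K : Type*} [Finite K] {s : K → ℝ} (hs : Function.Injective s)
    {v : K → ℝ} {M : ℝ} (hM : 0 ≤ M) (hv : ∀ k, |v k| ≤ M) :
    ∃ g : ℝ →ᵇ ℝ, ‖g‖ ≤ M ∧ ∀ k, g (s k) = v k := by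
  let _ : TopologicalSpace K := ⊥
  have : DiscreteTopology K := ⟨rfl⟩
  have hemb : Topology.IsClosedEmbedding s := continuous_of_discreteTopology.isClosedEmbedding hs
  let w : K →ᵇ ℝ := BoundedContinuousFunction.mkOfCompact ⟨v, continuous_of_discreteTopology⟩
  obtain ⟨g, hg, hgw⟩ :=
    BoundedContinuousFunction.exists_extension_norm_eq_of_isClosedEmbedding w hemb
  refine ⟨g, hg ▸ (BoundedContinuousFunction.norm_le hM).2 hv, fun k => congrFun hgw k⟩

theorem dist_projIcc_staircase_lt {L N : ℕ} (hL : 1 ≤ L) (hN : 0 < N) {δ : ℝ} (hδ : 2 / N < δ)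
    (q : Fin L) (x : unitInterval) :
    dist (Set.projIcc (0 : ℝ) 1 zero_le_one (staircase L (N * x + q / L) / N)) x < δ := by
  have hN' : (0 : ℝ) < N := by exact_mod_cast hN
  have hq0 : (0 : ℝ) ≤ q / L := by positivity
  have hq1 : (q / L : ℝ) ≤ 1 := div_le_one_of_le₀ (by exact_mod_cast q.2.le) (by positivity)
  have h := (LipschitzWith.projIcc (zero_le_one (α := ℝ))).dist_le_mul
    (staircase L (N * x + q / L) / N) x
  rw [Set.projIcc_val] at h
  refine h.trans_lt (lt_of_le_of_lt ?_ hδ)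
  have h1 := abs_le.1 (abs_staircase_sub_le hL (N * x + q / L))
  rw [NNReal.coe_one, one_mul, Real.dist_eq, div_sub' hN'.ne', abs_div, abs_of_pos hN']
  gcongr
  rw [abs_le]
  constructor <;> linarith [h1.1, h1.2]

/-- The perturbation step: near every system of inner functions there is one whose superpositions
approximate `f` with error at most `d / (d + 1) * ‖f‖ + ε`, with outer functions at most
`‖f‖ / (d + 1)`. -/
theorem exists_near_approx {d : ℕ} (φ₀ : Fin d → Fin (2 * d + 1) → C(unitInterval, ℝ))
    (f : C(Fin d → unitInterval, ℝ)) {ε : ℝ} (hε : 0 < ε) :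
    ∃ φ : Fin d → Fin (2 * d + 1) → C(unitInterval, ℝ), (∀ p q, dist (φ p q) (φ₀ p q) < ε) ∧
      ∃ g : Fin (2 * d + 1) → ℝ →ᵇ ℝ, (∀ q, ‖g q‖ ≤ ‖f‖ / (d + 1)) ∧
        ∀ x, |f x - ∑ q, g q (innerSum φ q x)| ≤ d / (d + 1) * ‖f‖ + ε := by
  classical
  have hL : 1 ≤ 2 * d + 1 := by omega
  have hd : (0 : ℝ) < d + 1 := by positivity
  obtain ⟨δ₁, hδ₁, hφ₀⟩ := Metric.uniformContinuous_iff.1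
    (CompactSpace.uniformContinuous_of_continuous
      (f := fun (x : unitInterval) (p : Fin d) (q : Fin (2 * d + 1)) => φ₀ p q x) (by fun_prop))
    (ε / 2) (by positivity)
  obtain ⟨δ₂, hδ₂, hf⟩ := Metric.uniformContinuous_iff.1
    (CompactSpace.uniformContinuous_of_continuous f.continuous) ε hε
  obtain ⟨N, hN⟩ := exists_nat_gt (2 / min δ₁ δ₂)
  have hN0 : (0 : ℝ) < N := lt_of_le_of_lt (by positivity) hN
  have hNδ : 2 / (N : ℝ) < min δ₁ δ₂ := by
    rw [div_lt_iff₀ (by positivity)] at hN ⊢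
    linarith
  have hN0' : 0 < N := by exact_mod_cast hN0
  -- `κ q` is constant on the steps of the `q`-th staircase; `node k` is close to all points of step
  -- `k`, clamped to the unit interval
  let node : ℝ → unitInterval := fun k => Set.projIcc (0 : ℝ) 1 zero_le_one (k / N)
  let κ : Fin (2 * d + 1) → unitInterval → ℝ := fun q x =>
    staircase (2 * d + 1) (N * x + q / (2 * d + 1 : ℕ))
  have hκc : ∀ q, Continuous (κ q) := fun q => by
    have := continuous_staircase hL
    fun_prop
  have hnode : Continuous node := continuous_projIcc.comp (by fun_prop)
  have hdist : ∀ q x, dist (node (κ q x)) x < min δ₁ δ₂ := fun q x =>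
    dist_projIcc_staircase_lt hL hN0' hNδ q x
  have hκ : ∀ q x, |κ q x| ≤ N + 2 := fun q x => by
    have h1 := abs_le.1 (abs_staircase_sub_le hL (N * x + q / (2 * d + 1 : ℕ)))
    have hq0 : (0 : ℝ) ≤ q / (2 * d + 1 : ℕ) := by positivity
    have hq1 : (q / (2 * d + 1 : ℕ) : ℝ) ≤ 1 :=
      div_le_one_of_le₀ (by exact_mod_cast q.2.le) (by positivity)
    have hx0 : 0 ≤ N * (x : ℝ) := mul_nonneg hN0.le x.2.1
    have hx1 : N * (x : ℝ) ≤ N := mul_le_of_le_one_right hN0.le x.2.2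
    rw [abs_le]
    constructor <;> linarith [h1.1, h1.2]
  -- adding `t (N + 1) ^ p κ q` to `φ₀ p q ∘ node ∘ κ q` separates the cells: its sum over `p` is
  -- `t` times the number with base `N + 1` digits `k p`
  obtain ⟨t, ht0, ht1, ht⟩ := exists_pos_lt_injective
    (fun (q : Fin (2 * d + 1)) (k : Fin d → Fin (N + 1)) => ∑ p, φ₀ p q (node (k p)))
    (injective_sum_mul_pow d (N + 1))
    (t₀ := ε / 2 / ((N + 2) * (N + 1) ^ d)) (by positivity)
  rw [lt_div_iff₀ (by positivity)] at ht1
  let φ : Fin d → Fin (2 * d + 1) → C(unitInterval, ℝ) := fun p q =>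
    ⟨fun x => φ₀ p q (node (κ q x)) + t * (κ q x * ((N + 1 : ℕ) : ℝ) ^ (p : ℕ)), by
      have := hκc q
      fun_prop⟩
  have hgex : ∀ q, ∃ g : ℝ →ᵇ ℝ, ‖g‖ ≤ ‖f‖ / (d + 1) ∧ ∀ k : Fin d → Fin (N + 1),
      g (∑ p, φ₀ p q (node (k p)) + t * ∑ p, (k p : ℝ) * ((N + 1 : ℕ) : ℝ) ^ (p : ℕ)) =
        f (fun p => node (k p)) / (d + 1) := fun q =>
    exists_boundedContinuous_eq (ht q) (by positivity) fun k => by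
      rw [abs_div, abs_of_pos hd]
      gcongr
      exact f.norm_coe_le_norm _
  choose g hgM hg using hgex
  refine ⟨φ, fun p q => ?_, g, hgM, fun x => ?_⟩
  · refine (ContinuousMap.dist_lt_iff hε).2 fun x => ?_
    have h1 : |φ₀ p q (node (κ q x)) - φ₀ p q x| < ε / 2 :=
      (dist_le_pi_dist _ _ q).trans_lt <| (dist_le_pi_dist _ _ p).trans_lt <|
        hφ₀ ((hdist q x).trans_le (min_le_left _ _))
    have h2 : |t * (κ q x * ((N + 1 : ℕ) : ℝ) ^ (p : ℕ))| < ε / 2 := by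
      refine lt_of_le_of_lt ?_ ht1
      rw [abs_mul, abs_of_pos ht0, abs_mul, abs_pow, Nat.abs_cast]
      push_cast
      gcongr
      · exact hκ q x
      · linarith
      · exact p.2.le
    rw [Real.dist_eq]
    calc |φ p q x - φ₀ p q x|
        = |(φ₀ p q (node (κ q x)) - φ₀ p q x) + t * (κ q x * ((N + 1 : ℕ) : ℝ) ^ (p : ℕ))| := by
          simp only [φ, ContinuousMap.coe_mk]; ring_nf
      _ ≤ _ := abs_add_le _ _
      _ < ε := by linarith
  · -- the indices for which some coordinate of `x` is on a rise
    set B := Finset.univ.filter fun q : Fin (2 * d + 1) => ∃ p, ((2 * d + 1 : ℕ) : ℝ) - 1 <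
      (2 * d + 1 : ℕ) * Int.fract ((N * x p : ℝ) + q / (2 * d + 1 : ℕ)) with hB
    have hBc : B.card ≤ d := card_filter_exists_lt_fract_le fun p => (N * x p : ℝ)
    refine abs_sub_sum_le (G := Bᶜ)
      (by rw [Finset.card_compl, Fintype.card_fin]; omega)
      (fun q => ((g q).norm_coe_le_norm _).trans (hgM q)) fun q hq => ?_
    have hq' : ∀ p, κ q (x p) = ⌊(N * x p : ℝ) + q / (2 * d + 1 : ℕ)⌋ := fun p => by
      refine staircase_eq_floor (not_lt.1 fun h => ?_)
      simp only [hB, Finset.mem_compl, Finset.mem_filter, Finset.mem_univ, true_and] at hq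
      exact hq ⟨p, h⟩
    have hk : ∀ p, ∃ k : Fin (N + 1), κ q (x p) = k := fun p => by
      have hlt : (q : ℝ) < (2 * d + 1 : ℕ) := by exact_mod_cast q.2
      have hq0 : (0 : ℝ) ≤ q / (2 * d + 1 : ℕ) := by positivity
      have hq1 : (q / (2 * d + 1 : ℕ) : ℝ) < 1 := (div_lt_one (by positivity)).2 hlt
      have hx0 : 0 ≤ N * (x p : ℝ) := mul_nonneg hN0.le (x p).2.1
      have hx1 : N * (x p : ℝ) ≤ N := mul_le_of_le_one_right hN0.le (x p).2.2
      refine ⟨⟨⌊(N * x p : ℝ) + q / (2 * d + 1 : ℕ)⌋₊,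
        (Nat.floor_lt (by positivity)).2 (by push_cast at hq1 ⊢; linarith)⟩, ?_⟩
      rw [hq' p]
      exact (natCast_floor_eq_intCast_floor (by positivity)).symm
    choose k hk using hk
    have hs : innerSum φ q x = ∑ p, φ₀ p q (node (k p)) +
        t * ∑ p, (k p : ℝ) * ((N + 1 : ℕ) : ℝ) ^ (p : ℕ) := by
      simp only [innerSum, φ, ContinuousMap.coe_mk, hk, Finset.sum_add_distrib, Finset.mul_sum]
    rw [hs, hg q k, ← sub_div, abs_div, abs_of_pos hd, abs_sub_comm]
    gcongr
    refine (hf ((dist_pi_lt_iff hδ₂).2 fun p => ?_)).le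
    rw [← hk p]
    exact (hdist q (x p)).trans_le (min_le_right _ _)

/-! ### The superposition operator -/

/-- `innerSum φ q` as an element of the normed space of continuous functions on the cube. -/
def innerSumMap {d m : ℕ} (φ : Fin d → Fin m → C(unitInterval, ℝ)) (q : Fin m) :
    C(Fin d → unitInterval, ℝ) :=
  ∑ p, (φ p q).comp (ContinuousMap.eval p)

theorem innerSumMap_apply {d m : ℕ} (φ : Fin d → Fin m → C(unitInterval, ℝ)) (q : Fin m)
    (x : Fin d → unitInterval) : innerSumMap φ q x = innerSum φ q x := by
  simp [innerSumMap, innerSum]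

theorem continuous_innerSumMap {d m : ℕ} (q : Fin m) :
    Continuous fun φ : Fin d → Fin m → C(unitInterval, ℝ) => innerSumMap φ q := by
  unfold innerSumMap
  refine continuous_finsetSum _ fun p _ => ?_
  exact (ContinuousMap.continuous_precomp _).comp (by fun_prop)

/-- The operator `g ↦ ∑ q, g q ∘ innerSum φ q` on bounded continuous outer functions. -/
noncomputable def superpose {d m : ℕ} (φ : Fin d → Fin m → C(unitInterval, ℝ)) :
    (Fin m → ℝ →ᵇ ℝ) →L[ℝ] C(Fin d → unitInterval, ℝ) :=
  LinearMap.mkContinuous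
    { toFun := fun g => ∑ q, (g q).toContinuousMap.comp (innerSumMap φ q)
      map_add' := fun g h => by ext x; simp [Finset.sum_add_distrib]
      map_smul' := fun c g => by ext x; simp [Finset.mul_sum] } m fun g => by
    refine (ContinuousMap.norm_le _ (by positivity)).2 fun x => ?_
    simp only [LinearMap.coe_mk, AddHom.coe_mk, ContinuousMap.coe_sum, Finset.sum_apply]
    refine (norm_sum_le _ _).trans ?_
    refine (Finset.sum_le_card_nsmul _ _ ‖g‖ fun q _ =>
      ((g q).norm_coe_le_norm _).trans (norm_le_pi_norm g q)).trans ?_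
    simp

theorem superpose_eq_sum {d m : ℕ} (φ : Fin d → Fin m → C(unitInterval, ℝ))
    (g : Fin m → ℝ →ᵇ ℝ) :
    superpose φ g = ∑ q, (g q).toContinuousMap.comp (innerSumMap φ q) := rfl

theorem superpose_apply {d m : ℕ} (φ : Fin d → Fin m → C(unitInterval, ℝ))
    (g : Fin m → ℝ →ᵇ ℝ) (x : Fin d → unitInterval) :
    superpose φ g x = ∑ q, g q (innerSum φ q x) := by
  simp [superpose_eq_sum, innerSumMap_apply]

theorem continuous_superpose {d m : ℕ} (g : Fin m → ℝ →ᵇ ℝ) :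
    Continuous fun φ : Fin d → Fin m → C(unitInterval, ℝ) => superpose φ g := by
  simp only [superpose_eq_sum]
  exact continuous_finsetSum _ fun q _ =>
    (ContinuousMap.continuous_postcomp _).comp (continuous_innerSumMap q)

/-! ### The Baire category argument -/

/-- The systems of inner functions for which some outer functions bounded by `‖f‖` approximate `f`
with error less than a fixed proportion of `‖f‖`. It is empty for `f = 0`. -/
def approxSet (d : ℕ) (f : C(Fin d → unitInterval, ℝ)) :
    Set (Fin d → Fin (2 * d + 1) → C(unitInterval, ℝ)) :=
  {φ | ∃ g : Fin (2 * d + 1) → ℝ →ᵇ ℝ, ‖g‖ ≤ ‖f‖ ∧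
    ‖f - superpose φ g‖ < (1 - 1 / (2 * (d + 1))) * ‖f‖}

theorem isOpen_approxSet (d : ℕ) (f : C(Fin d → unitInterval, ℝ)) : IsOpen (approxSet d f) := by
  have : approxSet d f = ⋃ g ∈ {g : Fin (2 * d + 1) → ℝ →ᵇ ℝ | ‖g‖ ≤ ‖f‖},
      {φ | ‖f - superpose φ g‖ < (1 - 1 / (2 * (d + 1))) * ‖f‖} := by
    ext φ; simp [approxSet]
  rw [this]
  exact isOpen_biUnion fun g _ => isOpen_lt
    (continuous_const.sub (continuous_superpose g)).norm continuous_const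

theorem dense_approxSet (d : ℕ) {f : C(Fin d → unitInterval, ℝ)} (hf : f ≠ 0) :
    Dense (approxSet d f) := by
  rw [Metric.dense_iff]
  intro φ₀ ε hε
  have hf' : 0 < ‖f‖ := norm_pos_iff.2 hf
  have hd : (0 : ℝ) < d + 1 := by positivity
  obtain ⟨φ, hφ, g, hg, hfg⟩ := exists_near_approx φ₀ f
    (ε := min ε (‖f‖ / (4 * (d + 1)))) (by positivity)
  refine ⟨φ, ?_, g, ?_, ?_⟩
  · exact (dist_pi_lt_iff hε).2 fun p => (dist_pi_lt_iff hε).2 fun q =>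
      (hφ p q).trans_le (min_le_left _ _)
  · exact (pi_norm_le_iff_of_nonneg hf'.le).2 fun q =>
      (hg q).trans (div_le_self hf'.le (by linarith [d.cast_nonneg (α := ℝ)]))
  · have h1 : d / (d + 1) * ‖f‖ + ‖f‖ / (4 * (d + 1)) < (1 - 1 / (2 * (d + 1))) * ‖f‖ := by
      have : (1 - 1 / (2 * (d + 1))) * ‖f‖ - (d / (d + 1) * ‖f‖ + ‖f‖ / (4 * (d + 1)))
          = ‖f‖ / (4 * (d + 1)) := by field_simp; ring
      have h3 : 0 < ‖f‖ / (4 * (d + 1)) := by positivity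
      linarith
    refine lt_of_le_of_lt ((ContinuousMap.norm_le _ (by positivity)).2 fun x => ?_) h1
    rw [ContinuousMap.sub_apply, superpose_apply, Real.norm_eq_abs]
    exact (hfg x).trans (by gcongr; exact min_le_right _ _)

/-- **Kolmogorov's superposition theorem**. -/
theorem exists_isKolmogorov (d : ℕ) :
    ∃ φ : Fin d → Fin (2 * d + 1) → C(unitInterval, ℝ), IsKolmogorov φ := by
  obtain ⟨D, hDc, hD⟩ := TopologicalSpace.exists_countable_dense C(Fin d → unitInterval, ℝ)
  have : BaireSpace (Fin d → Fin (2 * d + 1) → C(unitInterval, ℝ)) :=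
    .of_completelyPseudoMetrizable
  obtain ⟨φ, hφ⟩ := (dense_biInter_of_isOpen (S := D \ {0}) (f := approxSet d)
    (fun f _ => isOpen_approxSet d f) (hDc.mono Set.sdiff_subset)
    (fun f hf => dense_approxSet d hf.2)).nonempty
  simp only [Set.mem_iInter] at hφ
  set ρ : ℝ := 1 / (2 * (d + 1)) with hρ
  have hρ0 : 0 < ρ := by positivity
  have hρ1 : ρ ≤ 1 := by
    rw [hρ, div_le_one (by positivity)]; linarith [d.cast_nonneg (α := ℝ)]
  have hsurj : Function.Surjective (superpose φ) := by
    refine surjective_of_approx (superpose φ) (C := 2) (r := 1 - ρ / 2) (by linarith)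
      (by linarith) fun f => ?_
    rcases eq_or_ne f 0 with rfl | hf
    · exact ⟨0, by simp, by simp⟩
    have hf' : 0 < ‖f‖ := norm_pos_iff.2 hf
    -- half of the gain `ρ` pays for replacing `f` by a nearby `h` in the dense set
    obtain ⟨h, hhD, hfh⟩ := Metric.dense_iff.1 hD f (ρ / 4 * ‖f‖) (by positivity)
    rw [Metric.mem_ball, dist_eq_norm, norm_sub_rev] at hhD
    have hle : ‖h‖ ≤ ‖f‖ + ‖f - h‖ := norm_le_norm_add_norm_sub f h
    have hh0 : h ≠ 0 := by
      rintro rfl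
      rw [sub_zero] at hhD
      nlinarith
    obtain ⟨g, hg, hgh⟩ := hφ h ⟨hfh, hh0⟩
    refine ⟨g, by nlinarith, ?_⟩
    have h1 : ‖f - superpose φ g‖ ≤ ‖f - h‖ + ‖h - superpose φ g‖ :=
      norm_sub_le_norm_sub_add_norm_sub _ _ _
    have h2 : (1 - ρ) * ‖h‖ ≤ (1 - ρ) * (‖f‖ + ρ / 4 * ‖f‖) := by
      gcongr
      linarith
    nlinarith [mul_nonneg (mul_nonneg hρ0.le hρ0.le) hf'.le]
  refine ⟨φ, fun f hf => ?_⟩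
  obtain ⟨g, hg⟩ := hsurj ⟨f, hf⟩
  exact ⟨fun q => g q, fun q => (g q).continuous, fun x => by
    rw [← superpose_apply, hg, ContinuousMap.coe_mk]⟩

theorem corollary3p2 (d : ℕ) (hd : 2 ≤ d) :
    (∃ φ : Fin d → Fin (2 * d + 1) → C(unitInterval, ℝ), IsKolmogorov φ) ∧
    ∀ φ : Fin d → Fin (2 * d + 1) → C(unitInterval, ℝ), IsKolmogorov φ →
      ∀ f : (Fin d → unitInterval) → ℝ,
        ∃ g : Fin (2 * d + 1) → ℝ → ℝ, ∀ x, f x = ∑ q, g q (innerSum φ q x) := by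
  refine ⟨exists_isKolmogorov d, fun φ hφ => exists_eq_sum_comp (innerSum φ) ?_⟩
  refine finsupp_eq_zero_of_mapDomain_eq_zero (innerSum φ) fun f hf => ?_
  obtain ⟨g, -, hg⟩ := hφ f hf
  exact ⟨g, hg⟩
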